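/- Work with points $(x,X,y,Y_{12})$, where $x,y\in\mathbb{R}^2$, $X$ is a real symmetric $2\times 2$ matrix and $Y_{12}\in\mathbb{R}$. Let $$\mathcal{H}:=\operatorname{conv}\{(x,xx^T,y,y_1y_2)\;:\;x\in\mathbb{R}^2,\ y\in\{0,1\}^2,\ 0\le x\le y\}.$$ For $\alpha\in\mathbb{R}^2$ consider the linear constraints (L1) $X_{11}\le x_1\le y_1$ and $X_{22}\le x_2\le y_2$; (L2) $\max\{0,\;x_1-\alpha_1+x_2-\alpha_2-Y_{12}\}\le X_{12}\le\min\{x_1-\alpha_1,\;x_2-\alpha_2\}$; (L3) $0\le\alpha_j\le y_j-Y_{12}$ for $j=1,2$; (L4) $\max\{0,\;y_1+y_2-1\}\le Y_{12}\le\min\{y_1,y_2\}$. For $\beta\in\mathbb{R}^2$ put $$M(\beta):=\begin{pmatrix}Y_{12}&x_1-\alpha_1&x_2-\alpha_2\\x_1-\alpha_1&X_{11}-\beta_1&X_{12}\\x_2-\alpha_2&X_{12}&X_{22}-\beta_2\end{pmatrix},$$ and let $\ell_j:=X_{jj}-x_j+\alpha_j$ and $p_j:=\alpha_j^2/(y_j-Y_{12})$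 with $0/0:=0$ (under (L3), $y_j=Y_{12}$ forces $\alpha_j=0$). Set $\beta_{11}:=(\ell_1,\ell_2)$, $\beta_{12}:=(\ell_1,p_2)$, $\beta_{21}:=(p_1,\ell_2)$, $\beta_{22}:=(p_1,p_2)$. Here $\succeq 0$ means positive semidefinite. Let $\mathcal{L}$ be the set of all $(x,X,y,Y_{12},\alpha)$ satisfying (L1)–(L4) and $M(\beta_{22})\succeq 0$. **Theorem.** 1. $\mathcal{H}$ equals the projection of $\mathcal{L}$ onto $(x,X,y,Y_{12})$. 2. $\mathcal{L}$ is convex. 3. Whenever (L1)–(L4) hold, the condition $M(\beta_{22})\succeq 0$ is equivalent to $$\begin{pmatrix}y_1-Y_{12}&0&0&\alpha_1&0\\0&y_2-Y_{12}&0&0&\alpha_2\\0&0&Y_{12}&x_1-\alpha_1&x_2-\alpha_2\\\alpha_1&0&x_1-\alpha_1&X_{11}&X_{12}\\0&\alpha_2&x_2-\alpha_2&X_{12}&X_{22}\end{pmatrix}\succeq 0.$$ 4. The three conditions $M(\beta_{11})\succeq 0$, $M(\beta_{12})\succeq 0$, $M(\beta_{21})\succeq 0$ are redundant for the projection: the set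 of all $(x,X,y,Y_{12},\alpha)$ satisfying (L1)–(L4) and all four conditions $M(\beta_{pq})\succeq 0$, $p,q\in\{1,2\}$, has the same projection onto $(x,X,y,Y_{12})$ as $\mathcal{L}$. -/

import Mathlib

open Matrix

noncomputable section

namespace SwitchingHull

/-- The space of points `(x, X, y, Y₁₂)`. Coordinates `1, 2` of the mathematical text are the
indices `0, 1` of `Fin 2`; only symmetric matrices `X` are ever points of the sets below. -/
abbrev Point : Type :=
  (Fin 2 → ℝ) × Matrix (Fin 2) (Fin 2) ℝ × (Fin 2 → ℝ) × ℝ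

/-- The points `(x, x xᵀ, y, y₁ y₂)` with `0 ≤ x ≤ y` and `y ∈ {0,1}²`. -/
def generators : Set Point :=
  {p | ∃ x y : Fin 2 → ℝ, (∀ j, y j = 0 ∨ y j = 1) ∧ 0 ≤ x ∧ x ≤ y ∧
    p = (x, vecMulVec x x, y, y 0 * y 1)}

/-- The convex hull `𝓗` for `n = 2`. -/
def hull : Set Point := convexHull ℝ generators

/-- The polytope `RLT_y` of all `(y, Y₁₂)` satisfying the McCormick inequalities. -/
def RLTy : Set ((Fin 2 → ℝ) × ℝ) :=
  {q | max 0 (q.1 0 + q.1 1 - 1) ≤ q.2 ∧ q.2 ≤ min (q.1 0) (q.1 1)}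

/-- The linear constraints on `(x, X, y, Y₁₂, α)`, where `X` is a symmetric matrix. -/
structure LinearConstraints (x : Fin 2 → ℝ) (X : Matrix (Fin 2) (Fin 2) ℝ)
    (y : Fin 2 → ℝ) (Y : ℝ) (α : Fin 2 → ℝ) : Prop where
  symm : X.IsSymm
  diag_le : X.diag ≤ x
  le_y : x ≤ y
  lower : max 0 (x 0 - α 0 + (x 1 - α 1) - Y) ≤ X 0 1
  upper : X 0 1 ≤ min (x 0 - α 0) (x 1 - α 1)
  alpha_nonneg : ∀ j, 0 ≤ α j
  alpha_le : ∀ j, α j ≤ y j - Y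
  rlt : (y, Y) ∈ RLTy

/-- The matrix `M(β)` with blocks `Y₁₂`, `x - α` and `X - Diag β`. -/
def M (x : Fin 2 → ℝ) (X : Matrix (Fin 2) (Fin 2) ℝ) (Y : ℝ) (α β : Fin 2 → ℝ) :
    Matrix (Fin 3) (Fin 3) ℝ :=
  !![Y, x 0 - α 0, x 1 - α 1;
     x 0 - α 0, X 0 0 - β 0, X 0 1;
     x 1 - α 1, X 1 0, X 1 1 - β 1]

/-- The `j`-th entry `X_jj - x_j + α_j`, the first of the two choices for `β_j`. -/
def betaLin (x : Fin 2 → ℝ) (X : Matrix (Fin 2) (Fin 2) ℝ) (α : Fin 2 → ℝ) (j : Fin 2) : ℝ :=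
  X j j - x j + α j

/-- The `j`-th entry `(y_j - Y₁₂)⁻¹ α_j²`, the second of the two choices for `β_j`. If
`y_j = Y₁₂`, the linear constraints force `α_j = 0`, and the value is `0`: the convention
`0 / 0 = 0`. -/
def betaPersp (y : Fin 2 → ℝ) (Y : ℝ) (α : Fin 2 → ℝ) (j : Fin 2) : ℝ :=
  (y j - Y)⁻¹ * α j ^ 2

/-- The vector `β₁₁`. -/
def beta11 (x : Fin 2 → ℝ) (X : Matrix (Fin 2) (Fin 2) ℝ) (α : Fin 2 → ℝ) : Fin 2 → ℝ :=
  ![betaLin x X α 0, betaLin x X α 1]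

/-- The vector `β₂₁`. -/
def beta21 (x : Fin 2 → ℝ) (X : Matrix (Fin 2) (Fin 2) ℝ) (y : Fin 2 → ℝ) (Y : ℝ)
    (α : Fin 2 → ℝ) : Fin 2 → ℝ :=
  ![betaPersp y Y α 0, betaLin x X α 1]

/-- The vector `β₁₂`. -/
def beta12 (x : Fin 2 → ℝ) (X : Matrix (Fin 2) (Fin 2) ℝ) (y : Fin 2 → ℝ) (Y : ℝ)
    (α : Fin 2 → ℝ) : Fin 2 → ℝ :=
  ![betaLin x X α 0, betaPersp y Y α 1]

/-- The vector `β₂₂`. -/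
def beta22 (y : Fin 2 → ℝ) (Y : ℝ) (α : Fin 2 → ℝ) : Fin 2 → ℝ :=
  ![betaPersp y Y α 0, betaPersp y Y α 1]

/-- The `5 × 5` matrix that depends affinely on `(x, X, y, Y₁₂, α)`. -/
def M5 (x : Fin 2 → ℝ) (X : Matrix (Fin 2) (Fin 2) ℝ) (y : Fin 2 → ℝ) (Y : ℝ)
    (α : Fin 2 → ℝ) : Matrix (Fin 5) (Fin 5) ℝ :=
  !![y 0 - Y, 0, 0, α 0, 0;
     0, y 1 - Y, 0, 0, α 1;
     0, 0, Y, x 0 - α 0, x 1 - α 1;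
     α 0, 0, x 0 - α 0, X 0 0, X 0 1;
     0, α 1, x 1 - α 1, X 1 0, X 1 1]

/-- The tuples `((x, X, y, Y₁₂), α)` that satisfy the linear constraints and `M(β₂₂) ⪰ 0`. -/
def lifted : Set (Point × (Fin 2 → ℝ)) :=
  {q | ∃ (x : Fin 2 → ℝ) (X : Matrix (Fin 2) (Fin 2) ℝ) (y : Fin 2 → ℝ) (Y : ℝ) (α : Fin 2 → ℝ),
    q = ((x, X, y, Y), α) ∧ LinearConstraints x X y Y α ∧
    (M x X Y α (beta22 y Y α)).PosSemidef}

/-- The tuples `((x, X, y, Y₁₂), α)` that satisfy the linear constraints and all four conditions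
`M(β_pq) ⪰ 0`. -/
def liftedFour : Set (Point × (Fin 2 → ℝ)) :=
  {q | ∃ (x : Fin 2 → ℝ) (X : Matrix (Fin 2) (Fin 2) ℝ) (y : Fin 2 → ℝ) (Y : ℝ) (α : Fin 2 → ℝ),
    q = ((x, X, y, Y), α) ∧ LinearConstraints x X y Y α ∧
    (M x X Y α (beta11 x X α)).PosSemidef ∧
    (M x X Y α (beta12 x X y Y α)).PosSemidef ∧
    (M x X Y α (beta21 x X y Y α)).PosSemidef ∧
    (M x X Y α (beta22 y Y α)).PosSemidef}

end SwitchingHull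

end

/-! Think of `α j` as the share of `x j` carried by the vertex of `y` at which only `y j` is 1. A
generator then has an evident lift, and the lifted set is convex because `M5` is linear in the data
and its Schur complement is `M` at `beta22`. This gives one inclusion.

Conversely, a lifted point is split over the four vertices of `y`. One point per singleton vertex
accounts for `α j` with the least possible second moment, `betaPersp`. The remainder must be `Y`
times a point over the unit square, up to raising the diagonal (`exists_square_mem_hull`). That
needs the form to stay nonnegative when its diagonal is cut down to at most `x - α`, which the given
`α` may violate. The key lemma `exists_shift` repairs this one coordinate at a time, keeping `x`,
`X`, `y`, `Y` fixed. The repaired `α` satisfies all four matrix conditions, so the other three are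
redundant. Finally `raise_both_mem_hull` restores the diagonal of `X`. -/

namespace SwitchingHull

/-! ### Ternary quadratic forms and Schur complements -/

/-- Nonnegativity of the quadratic form of the symmetric matrix with rows
`(w, z₁, z₂)`, `(z₁, A, c)`, `(z₂, c, B)`. -/
def FormNonneg (w z₁ z₂ A c B : ℝ) : Prop :=
  ∀ u s t : ℝ,
    0 ≤ w * u ^ 2 + 2 * z₁ * u * s + 2 * z₂ * u * t + A * s ^ 2 + 2 * c * s * t + B * t ^ 2

theorem FormNonneg.swap {w z₁ z₂ A c B : ℝ} (h : FormNonneg w z₁ z₂ A c B) :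
    FormNonneg w z₂ z₁ B c A := fun u s t => by
  have := h u t s
  linarith

theorem FormNonneg.mono {w z₁ z₂ A A' c B B' : ℝ} (h : FormNonneg w z₁ z₂ A c B)
    (hA : A ≤ A') (hB : B ≤ B') : FormNonneg w z₁ z₂ A' c B' := fun u s t => by
  have := h u s t
  nlinarith [mul_le_mul_of_nonneg_right hA (sq_nonneg s),
    mul_le_mul_of_nonneg_right hB (sq_nonneg t)]

theorem FormNonneg.smul {w z₁ z₂ A c B : ℝ} (h : FormNonneg w z₁ z₂ A c B) {r : ℝ}
    (hr : 0 ≤ r) : FormNonneg (r * w) (r * z₁) (r * z₂) (r * A) (r * c) (r * B) :=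
  fun u s t => by
    have := mul_nonneg hr (h u s t)
    linarith

theorem FormNonneg.sq_le {w z₁ z₂ A c B : ℝ} (h : FormNonneg w z₁ z₂ A c B) (hw : 0 < w) :
    z₂ ^ 2 ≤ w * B := by
  have h1 := h (-z₂) 0 w
  have : 0 ≤ w * (w * B - z₂ ^ 2) := by linarith
  linarith [nonneg_of_mul_nonneg_right this hw]

/-- After eliminating `u`, the `t ^ 2` coefficient vanishes, so a nonzero mixed coefficient would
let `t` drive the form below zero. -/
theorem FormNonneg.mul_eq {w z₁ z₂ A c B : ℝ} (h : FormNonneg w z₁ z₂ A c B) (hw : 0 < w)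
    (hB : w * B = z₂ ^ 2) : w * c = z₁ * z₂ := by
  by_contra hne
  have hE : 0 < (w * c - z₁ * z₂) ^ 2 := by
    have : w * c - z₁ * z₂ ≠ 0 := sub_ne_zero.2 hne
    positivity
  set E := w * c - z₁ * z₂ with hEdef
  set k := w * A - z₁ ^ 2 with hk
  -- on `u = -(z₁ s + z₂ t) / w` the form is `(k s² + 2 E s t) / w`
  set t := -(k + 1) / (2 * E) with ht
  have hE0 : E ≠ 0 := by
    rintro h0
    simp [h0] at hE
  have h1 := h (-(z₁ + z₂ * t) / w) 1 t
  have h2 : w * (w * (-(z₁ + z₂ * t) / w) ^ 2 + 2 * z₁ * (-(z₁ + z₂ * t) / w) * 1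
      + 2 * z₂ * (-(z₁ + z₂ * t) / w) * t + A * 1 ^ 2 + 2 * c * 1 * t + B * t ^ 2)
      = k + 2 * E * t + (w * B - z₂ ^ 2) * t ^ 2 := by
    rw [hk, hEdef]
    field_simp
    ring
  have h3 : 2 * E * t = -(k + 1) := by
    rw [ht]
    field_simp
  have h4 := mul_nonneg hw.le h1
  rw [h2, h3, hB] at h4
  linarith

/-- Complete the square in `u`, then in `t`; the right-hand side is the coefficient of `s ^ 2` that
is left. -/
theorem formNonneg_iff_schur {w z₁ z₂ A c B : ℝ} (hw : 0 < w) (hD : 0 < w * B - z₂ ^ 2) :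
    FormNonneg w z₁ z₂ A c B ↔
      0 ≤ A - z₁ ^ 2 / w - (w * c - z₁ * z₂) ^ 2 / (w * (w * B - z₂ ^ 2)) := by
  have key : ∀ u s t : ℝ,
      w * u ^ 2 + 2 * z₁ * u * s + 2 * z₂ * u * t + A * s ^ 2 + 2 * c * s * t + B * t ^ 2
      = w * (u + (z₁ * s + z₂ * t) / w) ^ 2
        + (w * B - z₂ ^ 2) / w * (t + (w * c - z₁ * z₂) / (w * B - z₂ ^ 2) * s) ^ 2
        + (A - z₁ ^ 2 / w - (w * c - z₁ * z₂) ^ 2 / (w * (w * B - z₂ ^ 2))) * s ^ 2 := by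
    intro u s t
    have := hD.ne'
    field_simp
    ring
  constructor
  · intro h
    set t := -((w * c - z₁ * z₂) / (w * B - z₂ ^ 2)) with ht
    have h1 := h (-(z₁ * 1 + z₂ * t) / w) 1 t
    rw [key] at h1
    have e1 : -(z₁ * 1 + z₂ * t) / w + (z₁ * 1 + z₂ * t) / w = 0 := by ring
    have e2 : t + (w * c - z₁ * z₂) / (w * B - z₂ ^ 2) * 1 = 0 := by rw [ht]; ring
    rw [e1, e2] at h1
    linarith
  · intro h u s t
    rw [key]
    have := div_nonneg hD.le hw.le
    positivity

/-! ### McCormick inequalities and the shift of `α` -/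

/-- The homogenized McCormick inequalities for the product of `z₁` and `z₂`. -/
structure McCormick (w z₁ z₂ c : ℝ) : Prop where
  nonneg : 0 ≤ c
  lower : z₁ + z₂ - w ≤ c
  le_left : c ≤ z₁
  le_right : c ≤ z₂

theorem McCormick.swap {w z₁ z₂ c : ℝ} (h : McCormick w z₁ z₂ c) : McCormick w z₂ z₁ c :=
  ⟨h.nonneg, by linarith [h.lower], h.le_right, h.le_left⟩

/-- If `f` does not decrease as long as `h` is negative, then `h` becomes nonnegative while `f` is
still nonnegative, provided that it does so at the right end point at the latest. -/
theorem exists_nonneg_of_deriv {f f' h : ℝ → ℝ} {a b : ℝ} (hab : a ≤ b)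
    (hf : ∀ t, HasDerivAt f (f' t) t) (hh : Continuous h)
    (hmono : ∀ t ∈ Set.Icc a b, h t < 0 → 0 ≤ f' t) (ha : 0 ≤ f a) (hb : 0 ≤ f b → 0 ≤ h b) :
    ∃ t ∈ Set.Icc a b, 0 ≤ f t ∧ 0 ≤ h t := by
  have step : ∀ e ∈ Set.Icc a b, (∀ t ∈ Set.Ioo a e, h t < 0) → 0 ≤ f e := by
    intro e he hneg
    have hm : MonotoneOn f (Set.Icc a e) := by
      apply monotoneOn_of_deriv_nonneg (convex_Icc a e)
      · exact fun t _ => (hf t).continuousAt.continuousWithinAt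
      · exact fun t _ => (hf t).differentiableAt.differentiableWithinAt
      · intro t ht
        rw [interior_Icc] at ht
        rw [(hf t).deriv]
        exact hmono t ⟨ht.1.le, ht.2.le.trans he.2⟩ (hneg t ht)
    exact ha.trans (hm (Set.left_mem_Icc.2 he.1) (Set.right_mem_Icc.2 he.1) he.1)
  by_cases hex : ∃ t ∈ Set.Icc a b, 0 ≤ h t
  · have hc : IsCompact (Set.Icc a b ∩ {t | 0 ≤ h t}) :=
      isCompact_Icc.inter_right (isClosed_le continuous_const hh)
    obtain ⟨t₀, ht₀, ht₀'⟩ := hex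
    -- `e` is the first point with `0 ≤ h`; before it `h` is negative, so `f` has not decreased.
    obtain ⟨e, ⟨he, he'⟩, hmin⟩ := hc.exists_isLeast ⟨t₀, ht₀, ht₀'⟩
    refine ⟨e, he, step e he fun t ht => ?_, he'⟩
    by_contra hcon
    exact absurd (hmin ⟨⟨ht.1.le, ht.2.le.trans he.2⟩, not_lt.1 hcon⟩) (not_le.2 ht.2)
  · push Not at hex
    have hfb := step b (Set.right_mem_Icc.2 hab) fun t ht => hex t ⟨ht.1.le, ht.2.le⟩
    exact absurd (hb hfb) (not_le.2 (hex b (Set.right_mem_Icc.2 hab)))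

theorem formNonneg_degenerate {w z₁ z₂ A c B : ℝ} (h : FormNonneg w z₁ z₂ A c B) (hw : 0 < w)
    (hB : w * B = z₂ ^ 2) (h0 : 0 ≤ z₁) (h1 : z₁ ≤ w) : FormNonneg w z₁ z₂ z₁ c B := by
  have hc := h.mul_eq hw hB
  intro u s t
  have hz : 0 ≤ z₁ * (w - z₁) := mul_nonneg h0 (by linarith)
  have : w * (w * u ^ 2 + 2 * z₁ * u * s + 2 * z₂ * u * t + z₁ * s ^ 2 + 2 * c * s * t + B * t ^ 2)
      = (w * u + z₁ * s + z₂ * t) ^ 2 + z₁ * (w - z₁) * s ^ 2 := by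
    linear_combination (2 * s * t) * hc + t ^ 2 * hB
  refine nonneg_of_mul_nonneg_right ?_ hw
  rw [this]
  positivity

theorem formNonneg_of_right_zero {w z₁ A B : ℝ} (h : FormNonneg w z₁ 0 A 0 B) (h0 : 0 ≤ z₁)
    (h1 : z₁ ≤ w) : FormNonneg w z₁ 0 z₁ 0 B := by
  intro u s t
  have hB : 0 ≤ B := by simpa using h 0 0 1
  nlinarith [mul_nonneg h0 (sq_nonneg (u + s)), mul_nonneg (sub_nonneg.2 h1) (sq_nonneg u),
    mul_nonneg hB (sq_nonneg t)]

section shift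

variable {w z z₂ c D : ℝ}

/-- `hneg` is the failure of the form with first diagonal entry `z`, cleared of denominators; the
conclusion gives the sign of a derivative in `exists_shift`. With `E = w * c - z * z₂`, the bound `c
≤ z₂` yields `E ≤ z₂ * (w - z)`, hence `z * (w - z) * D < E ^ 2 ≤ z₂ * (w - z) * E`; cancel `w - z`.
-/
theorem mul_le_of_slope_nonneg_left (hD : 0 < D) (hcz : c ≤ z₂) (hw : 0 < w) (hz2 : 0 < z₂)
    (hle : z * z₂ ≤ w * c) (hneg : z * (w - z) * D < (w * c - z * z₂) ^ 2) (hz : 0 ≤ z) :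
    z * D ≤ z₂ * (w * c - z * z₂) := by
  set E := w * c - z * z₂ with hE
  have hE0 : 0 ≤ E := by linarith
  have hEle : E ≤ z₂ * (w - z) := by nlinarith
  have hwz : 0 ≤ w - z := nonneg_of_mul_nonneg_right (hE0.trans hEle) hz2
  have hEpos : 0 < E := by
    refine lt_of_le_of_ne hE0 fun h => ?_
    rw [← h] at hneg
    have : 0 ≤ z * (w - z) * D := by positivity
    linarith
  have hwz' : 0 < w - z := by
    refine lt_of_le_of_ne hwz fun h => ?_
    rw [← h] at hEle
    linarith
  have : (w - z) * (z * D) ≤ (w - z) * (z₂ * E) := by nlinarith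
  exact le_of_mul_le_mul_left this hwz'

/-- Mirror image: `0 ≤ c` bounds `G = z * z₂ - w * c` by `z * z₂`, and the factor `z` cancels. -/
theorem mul_le_of_slope_nonneg_right (hD : 0 < D) (hc : 0 ≤ c) (hw : 0 < w) (hzw : z ≤ w)
    (hle : w * c ≤ z * z₂) (hneg : z * (w - z) * D < (w * c - z * z₂) ^ 2) (hz : 0 ≤ z) :
    (w - z) * D ≤ z₂ * (z * z₂ - w * c) := by
  set G := z * z₂ - w * c with hG
  have hG0 : 0 ≤ G := by linarith
  have hGle : G ≤ z * z₂ := by nlinarith [mul_nonneg hw.le hc]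
  have hneg' : z * (w - z) * D < G ^ 2 := by
    rw [hG]; linarith
  have hwz : 0 ≤ w - z := by linarith
  have hGpos : 0 < G := by
    refine lt_of_le_of_ne hG0 fun h => ?_
    rw [← h] at hneg'
    have : 0 ≤ z * (w - z) * D := by positivity
    linarith
  have hz' : 0 < z := by
    refine lt_of_le_of_ne hz fun h => ?_
    rw [← h] at hGle
    linarith
  have : z * ((w - z) * D) ≤ z * (z₂ * G) := by nlinarith
  exact le_of_mul_le_mul_left this hz'

end shift

/-- Moving `α` so that `x - α` approaches `w c / z₂` makes the form with first diagonal entry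
`x - α` nonnegative before the one with entry `X - λ⁻¹ α²` turns negative. -/
theorem exists_shift {x X lam α w z₂ c B : ℝ} (hα : 0 ≤ α) (hαl : α ≤ lam) (hX : X ≤ x)
    (hw : 0 ≤ w) (hm : McCormick w (x - α) z₂ c)
    (hq : FormNonneg w (x - α) z₂ (X - lam⁻¹ * α ^ 2) c B) :
    ∃ α', 0 ≤ α' ∧ α' ≤ lam ∧ McCormick w (x - α') z₂ c ∧
      FormNonneg w (x - α') z₂ (min (X - lam⁻¹ * α' ^ 2) (x - α')) c B := by
  have of_both : ∀ α', FormNonneg w (x - α') z₂ (X - lam⁻¹ * α' ^ 2) c B →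
      FormNonneg w (x - α') z₂ (x - α') c B →
      FormNonneg w (x - α') z₂ (min (X - lam⁻¹ * α' ^ 2) (x - α')) c B := by
    intro α' h1 h2
    rcases min_choice (X - lam⁻¹ * α' ^ 2) (x - α') with h | h <;> rw [h] <;> assumption
  have hz0 : 0 ≤ x - α := hm.nonneg.trans hm.le_left
  have hzw : x - α ≤ w := by linarith [hm.lower, hm.le_right]
  have hz20 : 0 ≤ z₂ := hm.nonneg.trans hm.le_right
  have hz2w : z₂ ≤ w := by linarith [hm.lower, hm.le_left]
  rcases hz20.eq_or_lt with h2 | h2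
  · have hc : c = 0 := le_antisymm (by linarith [hm.le_right]) hm.nonneg
    subst h2 hc
    exact ⟨α, hα, hαl, hm, of_both α hq (formNonneg_of_right_zero hq hz0 hzw)⟩
  have hw' : 0 < w := h2.trans_le hz2w
  rcases (hq.sq_le hw').eq_or_lt with hD | hD
  · exact ⟨α, hα, hαl, hm, of_both α hq (formNonneg_degenerate hq hw' hD.symm hz0 hzw)⟩
  have hD' : 0 < w * B - z₂ ^ 2 := by linarith
  set D := w * B - z₂ ^ 2 with hDdef
  set L := lam⁻¹ with hL
  have hlam : 0 ≤ lam := hα.trans hαl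
  have hL0 : 0 ≤ L := inv_nonneg.2 hlam
  have hLl : L * lam ≤ 1 := by
    rw [hL]; exact inv_mul_le_one
  have hLll : L * lam ^ 2 = lam := by
    rcases hlam.eq_or_lt with h | h
    · rw [← h]; ring
    · rw [hL]; field_simp
  -- With `z = x - α`, `f` and `h` (below) are the Schur complements for first diagonal entry `X - L
  -- * α ^ 2` and `z`, respectively. A common `z` with both nonnegative is sought.
  set f : ℝ → ℝ := fun z => X - L * (x - z) ^ 2 - z ^ 2 / w - (w * c - z * z₂) ^ 2 / (w * D)
    with hf
  set f' : ℝ → ℝ := fun z => 2 * L * (x - z) - 2 * z / w + 2 * z₂ * (w * c - z * z₂) / (w * D)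
    with hf'
  set h : ℝ → ℝ := fun z => z - z ^ 2 / w - (w * c - z * z₂) ^ 2 / (w * D) with hh
  have hderiv : ∀ z, HasDerivAt f (f' z) z := by
    intro z
    have a1 := ((((hasDerivAt_id z).const_sub x).pow 2).const_mul L).const_sub X
    have a2 := ((hasDerivAt_id z).pow 2).div_const w
    have a3 := ((((hasDerivAt_id z).mul_const z₂).const_sub (w * c)).pow 2).div_const (w * D)
    refine ((a1.sub a2).sub a3).congr_deriv ?_
    simp only [hf', id]
    push_cast
    ring
  have hcont : Continuous h := by
    simp only [hh]
    fun_prop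
  have hneg_iff : ∀ z, h z < 0 → z * (w - z) * D < (w * c - z * z₂) ^ 2 := by
    intro z hz
    have e : h z * (w * D) = z * (w - z) * D - (w * c - z * z₂) ^ 2 := by
      simp only [hh]
      field_simp
    have := mul_neg_of_neg_of_pos hz (mul_pos hw' hD')
    linarith
  -- At `z = w * c / z₂` the mixed term vanishes, so `h` is nonnegative there; this target also
  -- respects the McCormick bounds.
  have hopt : w * c - w * c / z₂ * z₂ = 0 := by
    field_simp
    ring
  have hoptw : w * c / z₂ ≤ w := by
    rw [div_le_iff₀ h2]
    exact mul_le_mul_of_nonneg_left hm.le_right hw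
  have hopt0 : 0 ≤ w * c / z₂ := div_nonneg (mul_nonneg hw hm.nonneg) hz20
  have hoptc : c ≤ w * c / z₂ := by
    rw [le_div_iff₀ h2]
    nlinarith [hm.nonneg]
  have hoptu : w * c / z₂ ≤ w + c - z₂ := by
    rw [div_le_iff₀ h2]
    nlinarith [mul_nonneg (sub_nonneg.2 hz2w) (sub_nonneg.2 hm.le_right)]
  have hhopt : 0 ≤ h (w * c / z₂) := by
    simp only [hh, hopt]
    have : w * c / z₂ - (w * c / z₂) ^ 2 / w = (w * c / z₂) * (w - w * c / z₂) / w := by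
      field_simp
    have h3 : 0 ≤ (w * c / z₂) * (w - w * c / z₂) / w :=
      div_nonneg (mul_nonneg hopt0 (by linarith)) hw
    simp only [ne_eq, OfNat.ofNat_ne_zero, not_false_eq_true, zero_pow, zero_div, sub_zero]
    linarith
  have hfα : 0 ≤ f (x - α) := by
    have := (formNonneg_iff_schur hw' hD').1 hq
    simp only [hf]
    linarith [show L * (x - (x - α)) ^ 2 = L * α ^ 2 by ring]
  have finish : ∀ z, x - lam ≤ z → z ≤ x → c ≤ z → z ≤ w + c - z₂ → 0 ≤ f z → 0 ≤ h z →
      ∃ α', 0 ≤ α' ∧ α' ≤ lam ∧ McCormick w (x - α') z₂ c ∧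
        FormNonneg w (x - α') z₂ (min (X - L * α' ^ 2) (x - α')) c B := by
    intro z h3 h4 h5 h6 h7 h8
    have e : x - (x - z) = z := by ring
    refine ⟨x - z, by linarith, by linarith, ?_, of_both _ ?_ ?_⟩
    · rw [e]
      exact ⟨hm.nonneg, by linarith, h5, hm.le_right⟩
    · rw [e]
      exact (formNonneg_iff_schur hw' hD').2 h7
    · rw [e]
      exact (formNonneg_iff_schur hw' hD').2 h8
  rcases le_total (x - α) (w * c / z₂) with hle | hle
  · obtain ⟨z, ⟨hz1, hz2⟩, hz3, hz4⟩ := exists_nonneg_of_deriv (f := f) (f' := f') (h := h)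
      (a := x - α) (b := min (w * c / z₂) x) (le_min hle (by linarith)) hderiv hcont
      (fun z hz hneg => by
        have hzo : z ≤ w * c / z₂ := hz.2.trans (min_le_left _ _)
        have hzx : z ≤ x := hz.2.trans (min_le_right _ _)
        have hk := mul_le_of_slope_nonneg_left hD' hm.le_right hw' h2 ((le_div_iff₀ h2).1 hzo)
          (hneg_iff z hneg) (hz0.trans hz.1)
        have e : f' z = 2 * (L * (x - z)) + 2 * (z₂ * (w * c - z * z₂) - z * D) / (w * D) := by
          simp only [hf']
          field_simp
          ring
        rw [e]
        have h3 : 0 ≤ L * (x - z) := mul_nonneg hL0 (by linarith)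
        have h4 : 0 ≤ z₂ * (w * c - z * z₂) - z * D := by linarith
        positivity)
      hfα
      (fun hb => by
        -- The motion stops at the target or at `z = x`, that is `α = 0`, where `X ≤ x` gives `f ≤
        -- h`.
        rcases min_choice (w * c / z₂) x with hc | hc
        · rw [hc]; exact hhopt
        · rw [hc] at hb ⊢
          simp only [hf, hh, sub_self] at hb ⊢
          linarith)
    exact finish z (by linarith) (hz2.trans (min_le_right _ _)) (hm.le_left.trans hz1)
      ((hz2.trans (min_le_left _ _)).trans hoptu) hz3 hz4
  -- Here `z` decreases, hence the reflection. The motion stops at the target or at `α = lam`, where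
  -- `f` and `h` start from `X - lam` and `x - lam`, so again `f ≤ h`.
  · obtain ⟨z, ⟨hz1, hz2⟩, hz3, hz4⟩ := exists_nonneg_of_deriv (f := fun t => f (-t))
      (f' := fun t => -f' (-t)) (h := fun t => h (-t))
      (a := -(x - α)) (b := -max (w * c / z₂) (x - lam))
      (neg_le_neg (max_le hle (by linarith)))
      (fun t => by
        have := (hderiv (-t)).comp t (hasDerivAt_neg t)
        exact this.congr_deriv (by ring))
      (hcont.comp continuous_neg)
      (fun t hz hneg => by
        obtain ⟨z, rfl⟩ : ∃ z, t = -z := ⟨-t, by ring⟩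
        simp only [neg_neg] at hneg ⊢
        have hzm := neg_le_neg_iff.1 hz.2
        have hzo : w * c / z₂ ≤ z := (le_max_left _ _).trans hzm
        have hzx : x - lam ≤ z := (le_max_right _ _).trans hzm
        have hzα : z ≤ x - α := neg_le_neg_iff.1 hz.1
        have hk := mul_le_of_slope_nonneg_right hD' hm.nonneg hw' (hzα.trans hzw) ((div_le_iff₀ h2).1 hzo)
          (hneg_iff z hneg) (hopt0.trans hzo)
        have e : -f' z = 2 * (1 - L * (x - z))
            + 2 * (z₂ * (z * z₂ - w * c) - (w - z) * D) / (w * D) := by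
          simp only [hf']
          field_simp
          ring
        rw [e]
        have h3 : 0 ≤ 1 - L * (x - z) := by
          have := mul_le_mul_of_nonneg_left (show x - z ≤ lam by linarith) hL0
          linarith
        have h4 : 0 ≤ z₂ * (z * z₂ - w * c) - (w - z) * D := by linarith
        positivity)
      (by simpa using hfα)
      (fun hb => by
        simp only [neg_neg] at hb ⊢
        rcases max_choice (w * c / z₂) (x - lam) with hc | hc
        · rw [hc]; exact hhopt
        · rw [hc] at hb ⊢
          simp only [hf, hh, sub_sub_cancel, hLll] at hb ⊢
          linarith)
    have hz2' := le_neg_of_le_neg hz2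
    exact finish (-z) ((le_max_right _ _).trans hz2') (by linarith)
      (hoptc.trans ((le_max_left _ _).trans hz2')) (by linarith [hm.lower]) hz3 hz4

/-- Shifting first `α₁` and then `α₂` makes all four forms nonnegative. -/
theorem exists_shift_both {x₁ x₂ X₁ X₂ l₁ l₂ α₁ α₂ w c : ℝ} (hα₁ : 0 ≤ α₁) (hl₁ : α₁ ≤ l₁)
    (hX₁ : X₁ ≤ x₁) (hα₂ : 0 ≤ α₂) (hl₂ : α₂ ≤ l₂) (hX₂ : X₂ ≤ x₂) (hw : 0 ≤ w)
    (hm : McCormick w (x₁ - α₁) (x₂ - α₂) c)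
    (hq : FormNonneg w (x₁ - α₁) (x₂ - α₂) (X₁ - l₁⁻¹ * α₁ ^ 2) c (X₂ - l₂⁻¹ * α₂ ^ 2)) :
    ∃ a₁ a₂, 0 ≤ a₁ ∧ a₁ ≤ l₁ ∧ 0 ≤ a₂ ∧ a₂ ≤ l₂ ∧ McCormick w (x₁ - a₁) (x₂ - a₂) c ∧
      FormNonneg w (x₁ - a₁) (x₂ - a₂) (min (X₁ - l₁⁻¹ * a₁ ^ 2) (x₁ - a₁)) c
        (min (X₂ - l₂⁻¹ * a₂ ^ 2) (x₂ - a₂)) := by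
  obtain ⟨a₁, h1, h2, h3, h4⟩ := exists_shift hα₁ hl₁ hX₁ hw hm hq
  -- The last diagonal entry is arbitrary in `exists_shift`, so the minimum gained in the first
  -- coordinate survives the second shift.
  obtain ⟨a₂, h5, h6, h7, h8⟩ := exists_shift hα₂ hl₂ hX₂ hw h3.swap h4.swap
  exact ⟨a₁, a₂, h1, h2, h5, h6, h7.swap, h8.swap⟩

/-! ### Matrix conditions as quadratic forms -/

theorem posSemidef_M_iff {x : Fin 2 → ℝ} {X : Matrix (Fin 2) (Fin 2) ℝ} (hX : X.IsSymm) (Y : ℝ)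
    (α β : Fin 2 → ℝ) :
    (M x X Y α β).PosSemidef ↔
      FormNonneg Y (x 0 - α 0) (x 1 - α 1) (X 0 0 - β 0) (X 0 1) (X 1 1 - β 1) := by
  have h10 : X 1 0 = X 0 1 := hX.apply 0 1
  have key : ∀ v : Fin 3 → ℝ, star v ⬝ᵥ (M x X Y α β *ᵥ v) =
      Y * v 0 ^ 2 + 2 * (x 0 - α 0) * v 0 * v 1 + 2 * (x 1 - α 1) * v 0 * v 2
        + (X 0 0 - β 0) * v 1 ^ 2 + 2 * X 0 1 * v 1 * v 2 + (X 1 1 - β 1) * v 2 ^ 2 := by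
    intro v
    simp [M, dotProduct, mulVec, Fin.sum_univ_three, h10]
    ring
  rw [posSemidef_iff_dotProduct_mulVec]
  constructor
  · rintro ⟨-, h⟩ u s t
    have := h ![u, s, t]
    rw [key] at this
    simpa using this
  · refine fun h => ⟨?_, fun v => ?_⟩
    · ext i j
      fin_cases i <;> fin_cases j <;> simp [M, h10]
    · rw [key]
      exact h _ _ _

theorem posSemidef_M5_iff {x : Fin 2 → ℝ} {X : Matrix (Fin 2) (Fin 2) ℝ} (hX : X.IsSymm)
    (y : Fin 2 → ℝ) (Y : ℝ) (α : Fin 2 → ℝ) :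
    (M5 x X y Y α).PosSemidef ↔ ∀ a b u s t : ℝ,
      0 ≤ (y 0 - Y) * a ^ 2 + 2 * α 0 * a * s + ((y 1 - Y) * b ^ 2 + 2 * α 1 * b * t)
        + (Y * u ^ 2 + 2 * (x 0 - α 0) * u * s + 2 * (x 1 - α 1) * u * t
          + X 0 0 * s ^ 2 + 2 * X 0 1 * s * t + X 1 1 * t ^ 2) := by
  have h10 : X 1 0 = X 0 1 := hX.apply 0 1
  have key : ∀ v : Fin 5 → ℝ, star v ⬝ᵥ (M5 x X y Y α *ᵥ v) =
      (y 0 - Y) * v 0 ^ 2 + 2 * α 0 * v 0 * v 3 + ((y 1 - Y) * v 1 ^ 2 + 2 * α 1 * v 1 * v 4)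
        + (Y * v 2 ^ 2 + 2 * (x 0 - α 0) * v 2 * v 3 + 2 * (x 1 - α 1) * v 2 * v 4
          + X 0 0 * v 3 ^ 2 + 2 * X 0 1 * v 3 * v 4 + X 1 1 * v 4 ^ 2) := by
    intro v
    simp [M5, dotProduct, mulVec, Fin.sum_univ_five, h10]
    ring
  rw [posSemidef_iff_dotProduct_mulVec]
  constructor
  · rintro ⟨-, h⟩ a b u s t
    have := h ![a, b, u, s, t]
    rw [key] at this
    simpa using this
  · refine fun h => ⟨?_, fun v => ?_⟩
    · ext i j
      fin_cases i <;> fin_cases j <;> simp [M5, h10]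
    · rw [key]
      exact h _ _ _ _ _

/-- For `l = 0` both sides vanish, since `α = 0` is forced. -/
theorem perspective_sq {l α : ℝ} (h0 : 0 ≤ α) (hl : α ≤ l) (a s : ℝ) :
    l * a ^ 2 + 2 * α * a * s = l * (a + l⁻¹ * α * s) ^ 2 - l⁻¹ * α ^ 2 * s ^ 2 := by
  rcases (h0.trans hl).eq_or_lt with h | h
  · have : α = 0 := by linarith
    subst this h
    simp
  · field_simp
    ring

/-- Minimizing the `5 × 5` form over its first two variables subtracts exactly `betaPersp` from the
diagonal of `X`. -/
theorem posSemidef_beta22_iff {x : Fin 2 → ℝ} {X : Matrix (Fin 2) (Fin 2) ℝ} {y : Fin 2 → ℝ}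
    {Y : ℝ} {α : Fin 2 → ℝ} (hL : LinearConstraints x X y Y α) :
    (M x X Y α (beta22 y Y α)).PosSemidef ↔ (M5 x X y Y α).PosSemidef := by
  rw [posSemidef_M_iff hL.symm, posSemidef_M5_iff hL.symm]
  have e0 := perspective_sq (hL.alpha_nonneg 0) (hL.alpha_le 0)
  have e1 := perspective_sq (hL.alpha_nonneg 1) (hL.alpha_le 1)
  simp only [beta22, betaPersp, Fin.isValue, cons_val_zero, cons_val_one]
  constructor
  · intro h a b u s t
    rw [e0, e1]
    have h1 := h u s t
    have h2 : 0 ≤ (y 0 - Y) * (a + (y 0 - Y)⁻¹ * α 0 * s) ^ 2 :=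
      mul_nonneg ((hL.alpha_nonneg 0).trans (hL.alpha_le 0)) (sq_nonneg _)
    have h3 : 0 ≤ (y 1 - Y) * (b + (y 1 - Y)⁻¹ * α 1 * t) ^ 2 :=
      mul_nonneg ((hL.alpha_nonneg 1).trans (hL.alpha_le 1)) (sq_nonneg _)
    linarith
  · intro h u s t
    have h1 := h (-((y 0 - Y)⁻¹ * α 0 * s)) (-((y 1 - Y)⁻¹ * α 1 * t)) u s t
    rw [e0, e1] at h1
    simp only [neg_add_cancel] at h1
    linarith

theorem mem_lifted_iff {x : Fin 2 → ℝ} {X : Matrix (Fin 2) (Fin 2) ℝ} {y : Fin 2 → ℝ} {Y : ℝ}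
    {α : Fin 2 → ℝ} : ((x, X, y, Y), α) ∈ lifted ↔
      LinearConstraints x X y Y α ∧ (M5 x X y Y α).PosSemidef := by
  constructor
  · rintro ⟨x', X', y', Y', α', h, hL, hM⟩
    simp only [Prod.mk.injEq] at h
    obtain ⟨⟨rfl, rfl, rfl, rfl⟩, rfl⟩ := h
    exact ⟨hL, (posSemidef_beta22_iff hL).1 hM⟩
  · rintro ⟨hL, hM⟩
    exact ⟨x, X, y, Y, α, rfl, hL, (posSemidef_beta22_iff hL).2 hM⟩

/-! ### Convexity of the lifted set and the easy inclusion -/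

/-- The linear constraints as inequalities between entries. -/
theorem linearConstraints_iff {x : Fin 2 → ℝ} {X : Matrix (Fin 2) (Fin 2) ℝ} {y : Fin 2 → ℝ}
    {Y : ℝ} {α : Fin 2 → ℝ} : LinearConstraints x X y Y α ↔
      X.IsSymm ∧ (∀ j, X j j ≤ x j) ∧ (∀ j, x j ≤ y j) ∧
        McCormick Y (x 0 - α 0) (x 1 - α 1) (X 0 1) ∧ (∀ j, 0 ≤ α j) ∧ (∀ j, α j ≤ y j - Y) ∧
        McCormick 1 (y 0) (y 1) Y := by
  constructor
  · rintro ⟨h1, h2, h3, h4, h5, h6, h7, h8, h9⟩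
    simp only [max_le_iff, le_min_iff] at h4 h5 h8 h9
    exact ⟨h1, h2, h3, ⟨h4.1, h4.2, h5.1, h5.2⟩, h6, h7, ⟨h8.1, h8.2, h9.1, h9.2⟩⟩
  · rintro ⟨h1, h2, h3, h4, h6, h7, h8⟩
    refine ⟨h1, h2, h3, ?_, ?_, h6, h7, ?_, ?_⟩ <;> simp only [max_le_iff, le_min_iff]
    exacts [⟨h4.nonneg, h4.lower⟩, ⟨h4.le_left, h4.le_right⟩, ⟨h8.nonneg, h8.lower⟩,
      ⟨h8.le_left, h8.le_right⟩]

theorem McCormick.combo {w z₁ z₂ c w' z₁' z₂' c' a b : ℝ} (h : McCormick w z₁ z₂ c)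
    (h' : McCormick w' z₁' z₂' c') (ha : 0 ≤ a) (hb : 0 ≤ b) :
    McCormick (a * w + b * w') (a * z₁ + b * z₁') (a * z₂ + b * z₂') (a * c + b * c') := by
  obtain ⟨h1, h2, h3, h4⟩ := h
  obtain ⟨h1', h2', h3', h4'⟩ := h'
  constructor
  · positivity
  · linarith [mul_le_mul_of_nonneg_left h2 ha, mul_le_mul_of_nonneg_left h2' hb]
  · linarith [mul_le_mul_of_nonneg_left h3 ha, mul_le_mul_of_nonneg_left h3' hb]
  · linarith [mul_le_mul_of_nonneg_left h4 ha, mul_le_mul_of_nonneg_left h4' hb]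

theorem convex_lifted : Convex ℝ lifted := by
  rintro ⟨⟨x, X, y, Y⟩, α⟩ hp ⟨⟨x', X', y', Y'⟩, α'⟩ hp' a b ha hb hab
  rw [mem_lifted_iff] at hp hp'
  obtain ⟨hL, hM⟩ := hp
  obtain ⟨hL', hM'⟩ := hp'
  simp only [Prod.smul_mk, Prod.mk_add_mk]
  rw [mem_lifted_iff]
  constructor
  · rw [linearConstraints_iff] at hL hL' ⊢
    obtain ⟨h1, h2, h3, h4, h5, h6, h7⟩ := hL
    obtain ⟨h1', h2', h3', h4', h5', h6', h7'⟩ := hL'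
    simp only [Pi.add_apply, Pi.smul_apply, Matrix.add_apply, Matrix.smul_apply, smul_eq_mul]
    refine ⟨(h1.smul a).add (h1'.smul b), fun j => ?_, fun j => ?_, ?_, fun j => ?_, fun j => ?_,
      ?_⟩
    · linarith [mul_le_mul_of_nonneg_left (h2 j) ha, mul_le_mul_of_nonneg_left (h2' j) hb]
    · linarith [mul_le_mul_of_nonneg_left (h3 j) ha, mul_le_mul_of_nonneg_left (h3' j) hb]
    · convert h4.combo h4' ha hb using 1 <;> ring
    · linarith [mul_nonneg ha (h5 j), mul_nonneg hb (h5' j)]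
    · linarith [mul_le_mul_of_nonneg_left (h6 j) ha, mul_le_mul_of_nonneg_left (h6' j) hb]
    · have := h7.combo h7' ha hb
      rwa [mul_one, mul_one, hab] at this
  · have e : M5 (a • x + b • x') (a • X + b • X') (a • y + b • y') (a • Y + b • Y')
        (a • α + b • α') = a • M5 x X y Y α + b • M5 x' X' y' Y' α' := by
      ext i j
      fin_cases i <;> fin_cases j <;> simp [M5] <;> ring
    rw [e]
    exact (hM.smul ha).add (hM'.smul hb)

theorem generators_subset : generators ⊆ Prod.fst '' lifted := by
  rintro p ⟨x, y, hy, hx0, hxy, rfl⟩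
  -- The factor `y j - y 0 * y 1` indicates that `y j` alone equals 1.
  refine ⟨((x, vecMulVec x x, y, y 0 * y 1), fun j => x j * (y j - y 0 * y 1)), ?_, rfl⟩
  have hx0' : ∀ j, 0 ≤ x j := hx0
  have hxy' : ∀ j, x j ≤ y j := hxy
  have hL : LinearConstraints x (vecMulVec x x) y (y 0 * y 1)
      (fun j => x j * (y j - y 0 * y 1)) := by
    rw [linearConstraints_iff]
    have hz : ∀ j, y j = 0 → x j = 0 := fun j h => le_antisymm (h ▸ hxy' j) (hx0' j)
    have hx1 : ∀ j, x j ≤ 1 := fun j => (hxy' j).trans (by rcases hy j with h | h <;> simp [h])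
    have hx0'' := hx0' 0
    have hx1'' := hx0' 1
    have h01 := hx1 0
    have h11 := hx1 1
    have hd : ∀ j, 0 ≤ y j - y 0 * y 1 := by
      intro j
      fin_cases j <;> rcases hy 0 with h | h <;> rcases hy 1 with h' | h' <;> simp [h, h']
    refine ⟨?_, fun j => ?_, hxy', ?_, fun j => mul_nonneg (hx0' j) (hd j),
      fun j => mul_le_of_le_one_left (hd j) (hx1 j), ?_⟩
    · ext i j
      simp [vecMulVec_apply, mul_comm]
    · simp only [vecMulVec_apply]
      exact mul_le_of_le_one_left (hx0' j) (hx1 j)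
    · rcases hy 0 with h | h <;> rcases hy 1 with h' | h' <;>
        constructor <;> simp [vecMulVec_apply, h, h', hz 0, hz 1] <;> nlinarith
    · rcases hy 0 with h | h <;> rcases hy 1 with h' | h' <;>
        constructor <;> simp [h, h']
  refine mem_lifted_iff.2 ⟨hL, (posSemidef_beta22_iff hL).1 ((posSemidef_M_iff hL.symm _ _ _).2 ?_)⟩
  intro u s t
  have hz : ∀ j, y j = 0 → x j = 0 := fun j h => le_antisymm (h ▸ hxy' j) (hx0' j)
  rcases hy 0 with h | h <;> rcases hy 1 with h' | h' <;>
    simp [beta22, betaPersp, vecMulVec_apply, h, h', hz 0, hz 1, pow_two]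
  -- Only `y = (1, 1)` is left; the form is then this square.
  nlinarith [sq_nonneg (u + x 0 * s + x 1 * t)]

theorem hull_subset : hull ⊆ Prod.fst '' lifted :=
  convexHull_min generators_subset (convex_lifted.is_linear_image (LinearMap.fst ℝ _ _).isLinear)

/-! ### Redundancy of the other three conditions -/

/-- Since `X j j - betaLin x X α j = x j - α j`, the minima on the diagonal encode all four matrix
conditions at once, as well as the diagonal bounds needed over the unit square. -/
theorem exists_mem_liftedFour {x : Fin 2 → ℝ} {X : Matrix (Fin 2) (Fin 2) ℝ} {y : Fin 2 → ℝ}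
    {Y : ℝ} {α : Fin 2 → ℝ} (hL : LinearConstraints x X y Y α)
    (hM : (M x X Y α (beta22 y Y α)).PosSemidef) :
    ∃ α', LinearConstraints x X y Y α' ∧
      FormNonneg Y (x 0 - α' 0) (x 1 - α' 1)
        (min (X 0 0 - (y 0 - Y)⁻¹ * α' 0 ^ 2) (x 0 - α' 0)) (X 0 1)
        (min (X 1 1 - (y 1 - Y)⁻¹ * α' 1 ^ 2) (x 1 - α' 1)) := by
  have hL' := hL
  rw [linearConstraints_iff] at hL'
  obtain ⟨h1, h2, h3, h4, h5, h6, h7⟩ := hL'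
  rw [posSemidef_M_iff h1] at hM
  obtain ⟨a₁, a₂, g1, g2, g3, g4, g5, g6⟩ := exists_shift_both (h5 0) (h6 0) (h2 0) (h5 1) (h6 1)
    (h2 1) h7.nonneg h4 (by simpa [beta22, betaPersp] using hM)
  refine ⟨![a₁, a₂], linearConstraints_iff.2 ⟨h1, h2, h3, by simpa using g5, ?_, ?_, h7⟩,
    by simpa using g6⟩
  · simp [Fin.forall_fin_two, g1, g3]
  · simp [Fin.forall_fin_two, g2, g4]

theorem image_liftedFour : Prod.fst '' liftedFour = Prod.fst '' lifted := by
  apply subset_antisymm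
  · apply Set.image_mono
    rintro q ⟨x, X, y, Y, α, rfl, hL, -, -, -, h⟩
    exact ⟨x, X, y, Y, α, rfl, hL, h⟩
  · rintro _ ⟨_, ⟨x, X, y, Y, α, rfl, hL, hM⟩, rfl⟩
    obtain ⟨α', hL', hF⟩ := exists_mem_liftedFour hL hM
    refine ⟨((x, X, y, Y), α'), ⟨x, X, y, Y, α', rfl, hL', ?_, ?_, ?_, ?_⟩, rfl⟩ <;>
    · rw [posSemidef_M_iff hL.symm]
      refine hF.mono ?_ ?_ <;> first
        | exact min_le_left _ _
        | refine (min_le_right _ _).trans_eq ?_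
          simp only [beta11, beta12, beta21, betaLin, cons_val_zero, cons_val_one]
          ring

/-! ### Raising the diagonal inside the hull -/

theorem generator_mem_hull {x y : Fin 2 → ℝ} (hy : ∀ j, y j = 0 ∨ y j = 1) (hx : 0 ≤ x)
    (hxy : x ≤ y) : (x, vecMulVec x x, y, y 0 * y 1) ∈ hull :=
  subset_convexHull ℝ _ ⟨x, y, hy, hx, hxy, rfl⟩

/-- The linear map that replaces the entry `X_jj` of a point by `x_j`. -/
def saturate (j : Fin 2) : Point →ₗ[ℝ] Point where
  toFun p := (p.1, p.2.1 + Matrix.single j j (p.1 j - p.2.1 j j), p.2.2)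
  map_add' p q := by
    simp only [Prod.fst_add, Prod.snd_add, Prod.mk_add_mk, Pi.add_apply, Matrix.add_apply,
      add_sub_add_comm, Matrix.single_add]
    congr 2
    abel
  map_smul' r p := by
    simp only [Prod.smul_fst, Prod.smul_snd, Pi.smul_apply, Matrix.smul_apply, RingHom.id_apply,
      Prod.smul_mk, ← smul_sub, smul_add, Matrix.smul_single]

/-- By linearity only generators matter. If `y j = 0`, then `x j = 0` and nothing changes. If `y j =
1`, average the generators with `x j` replaced by 1 and 0, with weights `x j` and `1 - x j`: only
the entry `X j j` is not affine in `x j`. -/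
theorem saturate_mem_hull (j : Fin 2) {p : Point} (hp : p ∈ hull) : saturate j p ∈ hull := by
  have : Convex ℝ (saturate j ⁻¹' hull) :=
    (convex_convexHull ℝ generators).linear_preimage (saturate j)
  refine convexHull_min ?_ this hp
  rintro _ ⟨x, y, hy, hx, hxy, rfl⟩
  have hx' : ∀ i, 0 ≤ x i := hx
  have hxy' : ∀ i, x i ≤ y i := hxy
  rcases hy j with h | h
  · have h0 : x j = 0 := le_antisymm (h ▸ hxy' j) (hx' j)
    have : saturate j (x, vecMulVec x x, y, y 0 * y 1) = (x, vecMulVec x x, y, y 0 * y 1) := by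
      simp [saturate, vecMulVec_apply, h0]
    rw [Set.mem_preimage, this]
    exact generator_mem_hull hy hx hxy
  · have h1 : x j ≤ 1 := h ▸ hxy' j
    have m1 : (Function.update x j 1, vecMulVec (Function.update x j 1) (Function.update x j 1), y,
        y 0 * y 1) ∈ hull := by
      refine generator_mem_hull hy (fun i => ?_) fun i => ?_
      all_goals
        by_cases hi : i = j
        · subst hi; simp [h]
        · simp [hi, hx' i, hxy' i]
    have m0 : (Function.update x j 0, vecMulVec (Function.update x j 0) (Function.update x j 0), y,
        y 0 * y 1) ∈ hull := by
      refine generator_mem_hull hy (fun i => ?_) fun i => ?_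
      all_goals
        by_cases hi : i = j
        · subst hi; simp [h]
        · simp [hi, hx' i, hxy' i]
    have e : saturate j (x, vecMulVec x x, y, y 0 * y 1) =
        x j • (Function.update x j 1, vecMulVec (Function.update x j 1) (Function.update x j 1), y,
          y 0 * y 1) + (1 - x j) • (Function.update x j 0,
            vecMulVec (Function.update x j 0) (Function.update x j 0), y, y 0 * y 1) := by
      simp only [saturate, LinearMap.coe_mk, AddHom.coe_mk, Prod.smul_mk, Prod.mk_add_mk,
        Prod.mk.injEq]
      refine ⟨?_, ?_, ?_, ?_⟩
      · ext i
        fin_cases j <;> fin_cases i <;> simp [Function.update] <;> ring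
      · ext i k
        fin_cases j <;> fin_cases i <;> fin_cases k <;>
          simp [Function.update, vecMulVec_apply, Matrix.single] <;> ring
      · rw [← add_smul]; simp
      · rw [← add_smul]; simp
    rw [Set.mem_preimage, e]
    exact convex_convexHull ℝ _ m1 m0 (hx' j) (by linarith) (by ring)

/-- Diagonal entries of `X` may be raised up to the corresponding entries of `x`. -/
theorem raise_mem_hull {x : Fin 2 → ℝ} {X : Matrix (Fin 2) (Fin 2) ℝ} {y : Fin 2 → ℝ} {Y : ℝ}
    (h : (x, X, y, Y) ∈ hull) (j : Fin 2) {t : ℝ} (h0 : X j j ≤ t) (h1 : t ≤ x j) :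
    (x, X + Matrix.single j j (t - X j j), y, Y) ∈ hull := by
  rcases (h0.trans h1).eq_or_lt with he | hlt
  · have : t - X j j = 0 := by linarith
    simpa [this] using h
  set r := (t - X j j) / (x j - X j j) with hr
  have hpos : 0 < x j - X j j := by linarith
  have hr0 : 0 ≤ r := div_nonneg (by linarith) hpos.le
  have hr1 : r ≤ 1 := (div_le_one hpos).2 (by linarith)
  have hrt : r * (x j - X j j) = t - X j j := div_mul_cancel₀ _ hpos.ne'
  have e : (x, X + Matrix.single j j (t - X j j), y, Y) =
      r • saturate j (x, X, y, Y) + (1 - r) • (x, X, y, Y) := by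
    simp only [saturate, LinearMap.coe_mk, AddHom.coe_mk, Prod.smul_mk, Prod.mk_add_mk,
      smul_add, Matrix.smul_single, smul_eq_mul, hrt, Prod.mk.injEq]
    refine ⟨?_, ?_, ?_, by ring⟩
    · rw [← add_smul]; simp
    · rw [add_right_comm, ← add_smul]; simp
    · rw [← add_smul]; simp
  rw [e]
  exact convex_convexHull ℝ _ (saturate_mem_hull j h) h hr0 (by linarith) (by ring)

theorem raise_both_mem_hull {x₀ x₁ a b c a' b' : ℝ} {y : Fin 2 → ℝ} {Y : ℝ}
    (h : (![x₀, x₁], !![a, c; c, b], y, Y) ∈ hull) (ha : a ≤ a') (ha' : a' ≤ x₀) (hb : b ≤ b')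
    (hb' : b' ≤ x₁) : (![x₀, x₁], !![a', c; c, b'], y, Y) ∈ hull := by
  have h1 := raise_mem_hull h 0 (t := a') (by simpa using ha) (by simpa using ha')
  have e1 : !![a, c; c, b] + Matrix.single 0 0 (a' - !![a, c; c, b] 0 0) = !![a', c; c, b] := by
    ext i j
    fin_cases i <;> fin_cases j <;> simp [Matrix.single]
  rw [e1] at h1
  have h2 := raise_mem_hull h1 1 (t := b') (by simpa using hb) (by simpa using hb')
  have e2 : !![a', c; c, b] + Matrix.single 1 1 (b' - !![a', c; c, b] 1 1) = !![a', c; c, b'] := by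
    ext i j
    fin_cases i <;> fin_cases j <;> simp [Matrix.single]
  rwa [e2] at h2

/-! ### Moments over the unit square -/

/-- The four products say that each lower bound `uᵢ / rᵢ` for `a` is at most each upper bound `sⱼ /
uⱼ`; the larger lower bound works unless both `uᵢ` vanish. -/
theorem exists_step {u₁ u₂ r₁ r₂ s₁ s₂ : ℝ} (hu₁ : 0 ≤ u₁) (hu₂ : 0 ≤ u₂) (hr₁ : 0 ≤ r₁)
    (hr₂ : 0 ≤ r₂) (hs₁ : 0 ≤ s₁) (hs₂ : 0 ≤ s₂) (h11 : u₁ ^ 2 ≤ r₁ * s₁)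
    (h12 : u₁ * u₂ ≤ r₁ * s₂) (h21 : u₁ * u₂ ≤ r₂ * s₁) (h22 : u₂ ^ 2 ≤ r₂ * s₂) :
    ∃ a, 0 < a ∧ u₁ ≤ a * r₁ ∧ u₂ ≤ a * r₂ ∧ a * u₁ ≤ s₁ ∧ a * u₂ ≤ s₂ := by
  have hz₁ : r₁ = 0 → u₁ = 0 := fun h => by
    rw [h, zero_mul] at h11
    exact pow_eq_zero_iff two_ne_zero |>.1 (le_antisymm h11 (sq_nonneg _))
  have hz₂ : r₂ = 0 → u₂ = 0 := fun h => by
    rw [h, zero_mul] at h22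
    exact pow_eq_zero_iff two_ne_zero |>.1 (le_antisymm h22 (sq_nonneg _))
  have k : ∀ {u r s v : ℝ}, 0 ≤ r → 0 ≤ s → u * v ≤ r * s → u / r * v ≤ s := by
    intro u r s v hr hs h
    rcases hr.eq_or_lt with h0 | h0
    · rw [← h0]; simpa using hs
    · rw [div_mul_eq_mul_div, div_le_iff₀ h0]
      linarith
  have l : ∀ {u r : ℝ}, (r = 0 → u = 0) → u = u / r * r := by
    intro u r h
    by_cases h0 : r = 0
    · simp [h0, h h0]
    · field_simp
  have hpos : (u₁ = 0 ∧ u₂ = 0) ∨ 0 < max (u₁ / r₁) (u₂ / r₂) := by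
    rcases hu₁.eq_or_lt with h | h
    · rcases hu₂.eq_or_lt with h' | h'
      · exact Or.inl ⟨h.symm, h'.symm⟩
      · exact Or.inr (lt_max_of_lt_right
          (div_pos h' (lt_of_le_of_ne hr₂ fun e => h'.ne' (hz₂ e.symm))))
    · exact Or.inr (lt_max_of_lt_left
        (div_pos h (lt_of_le_of_ne hr₁ fun e => h.ne' (hz₁ e.symm))))
  rcases hpos with ⟨rfl, rfl⟩ | hpos
  · exact ⟨1, one_pos, by simpa, by simpa, by simpa, by simpa⟩
  refine ⟨max (u₁ / r₁) (u₂ / r₂), hpos, ?_, ?_, ?_, ?_⟩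
  · exact (l hz₁).le.trans (mul_le_mul_of_nonneg_right (le_max_left _ _) hr₁)
  · exact (l hz₂).le.trans (mul_le_mul_of_nonneg_right (le_max_right _ _) hr₂)
  · rw [max_mul_of_nonneg _ _ hu₁]
    exact max_le (k hr₁ hs₁ (by linarith)) (k hr₂ hs₁ (by linarith))
  · rw [max_mul_of_nonneg _ _ hu₂]
    exact max_le (k hr₁ hs₂ (by linarith)) (k hr₂ hs₂ (by linarith))

/-- A line through a point of the square contains points of the square on both sides whose
signed distances multiply to at least one, if the McCormick inequalities hold. -/
theorem exists_two_points {z₁ z₂ v₁ v₂ : ℝ} (h₁ : v₁ ^ 2 ≤ z₁ * (1 - z₁))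
    (h₂ : v₂ ^ 2 ≤ z₂ * (1 - z₂)) (hm : McCormick 1 z₁ z₂ (z₁ * z₂ + v₁ * v₂)) :
    ∃ a, 0 < a ∧ (0 ≤ z₁ - a * v₁ ∧ z₁ - a * v₁ ≤ 1) ∧ (0 ≤ z₂ - a * v₂ ∧ z₂ - a * v₂ ≤ 1) ∧
      (0 ≤ z₁ + a⁻¹ * v₁ ∧ z₁ + a⁻¹ * v₁ ≤ 1) ∧ (0 ≤ z₂ + a⁻¹ * v₂ ∧ z₂ + a⁻¹ * v₂ ≤ 1) := by
  obtain ⟨m1, m2, m3, m4⟩ := hm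
  have hz₁ : 0 ≤ z₁ := m1.trans m3
  have hz₂ : 0 ≤ z₂ := m1.trans m4
  have hz₁' : 0 ≤ 1 - z₁ := by linarith
  have hz₂' : 0 ≤ 1 - z₂ := by linarith
  have inv_le : ∀ {a u r : ℝ}, 0 < a → u ≤ a * r → a⁻¹ * u ≤ r := by
    intro a u r ha h
    rwa [inv_mul_le_iff₀ ha]
  -- The `rᵢ` and `sᵢ` of `exists_step` are the distances to the sides of the square hit along `v`
  -- and `-v`. For equal signs the mixed products are the McCormick upper bounds, for opposite signs
  -- the lower ones.
  rcases le_total 0 v₁ with s₁ | s₁ <;> rcases le_total 0 v₂ with s₂ | s₂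
  · obtain ⟨a, ha, k1, k2, k3, k4⟩ := exists_step s₁ s₂ hz₁' hz₂' hz₁ hz₂ (by linarith)
      (by linarith) (by linarith) (by linarith)
    have i1 := inv_le ha k1
    have i2 := inv_le ha k2
    have := inv_pos.2 ha
    have p1 := mul_nonneg ha.le s₁
    have p2 := mul_nonneg ha.le s₂
    have p3 := mul_nonneg this.le s₁
    have p4 := mul_nonneg this.le s₂
    refine ⟨a, ha, ⟨?_, ?_⟩, ⟨?_, ?_⟩, ⟨?_, ?_⟩, ⟨?_, ?_⟩⟩ <;> linarith
  · obtain ⟨a, ha, k1, k2, k3, k4⟩ := exists_step s₁ (neg_nonneg.2 s₂) hz₁' hz₂ hz₁ hz₂'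
      (by linarith) (by linarith) (by linarith) (by linarith)
    have i1 := inv_le ha k1
    have i2 := inv_le ha k2
    have := inv_pos.2 ha
    have p1 := mul_nonneg ha.le s₁
    have p2 := mul_nonneg ha.le (neg_nonneg.2 s₂)
    have p3 := mul_nonneg this.le s₁
    have p4 := mul_nonneg this.le (neg_nonneg.2 s₂)
    refine ⟨a, ha, ⟨?_, ?_⟩, ⟨?_, ?_⟩, ⟨?_, ?_⟩, ⟨?_, ?_⟩⟩ <;> linarith
  · obtain ⟨a, ha, k1, k2, k3, k4⟩ := exists_step (neg_nonneg.2 s₁) s₂ hz₁ hz₂' hz₁' hz₂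
      (by linarith) (by linarith) (by linarith) (by linarith)
    have i1 := inv_le ha k1
    have i2 := inv_le ha k2
    have := inv_pos.2 ha
    have p1 := mul_nonneg ha.le (neg_nonneg.2 s₁)
    have p2 := mul_nonneg ha.le s₂
    have p3 := mul_nonneg this.le (neg_nonneg.2 s₁)
    have p4 := mul_nonneg this.le s₂
    refine ⟨a, ha, ⟨?_, ?_⟩, ⟨?_, ?_⟩, ⟨?_, ?_⟩, ⟨?_, ?_⟩⟩ <;> linarith
  · obtain ⟨a, ha, k1, k2, k3, k4⟩ := exists_step (neg_nonneg.2 s₁) (neg_nonneg.2 s₂) hz₁ hz₂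
      hz₁' hz₂' (by linarith) (by linarith) (by linarith) (by linarith)
    have i1 := inv_le ha k1
    have i2 := inv_le ha k2
    have := inv_pos.2 ha
    have p1 := mul_nonneg ha.le (neg_nonneg.2 s₁)
    have p2 := mul_nonneg ha.le (neg_nonneg.2 s₂)
    have p3 := mul_nonneg this.le (neg_nonneg.2 s₁)
    have p4 := mul_nonneg this.le (neg_nonneg.2 s₂)
    refine ⟨a, ha, ⟨?_, ?_⟩, ⟨?_, ?_⟩, ⟨?_, ?_⟩, ⟨?_, ?_⟩⟩ <;> linarith

theorem generator_pair_mem_hull {x₀ x₁ y₀ y₁ : ℝ} (hy₀ : y₀ = 0 ∨ y₀ = 1) (hy₁ : y₁ = 0 ∨ y₁ = 1)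
    (hx₀ : 0 ≤ x₀) (hx₁ : 0 ≤ x₁) (h₀ : x₀ ≤ y₀) (h₁ : x₁ ≤ y₁) :
    (![x₀, x₁], !![x₀ ^ 2, x₀ * x₁; x₀ * x₁, x₁ ^ 2], ![y₀, y₁], y₀ * y₁) ∈ hull := by
  have := generator_mem_hull (x := ![x₀, x₁]) (y := ![y₀, y₁])
    (by simp [Fin.forall_fin_two, hy₀, hy₁])
    (by intro i; fin_cases i <;> simp [hx₀, hx₁]) (by intro i; fin_cases i <;> simp [h₀, h₁])
  have e : vecMulVec ![x₀, x₁] ![x₀, x₁] = !![x₀ ^ 2, x₀ * x₁; x₀ * x₁, x₁ ^ 2] := by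
    ext i j
    fin_cases i <;> fin_cases j <;> simp [vecMulVec_apply, pow_two, mul_comm]
  rwa [e] at this

/-- The points `z - a v` and `z + a⁻¹ v`, weighted in proportion to `a⁻¹` and `a`, have mean `z` and
covariance `v vᵀ`. -/
theorem rank_one_mem_hull {z₁ z₂ v₁ v₂ : ℝ} (h₁ : v₁ ^ 2 ≤ z₁ * (1 - z₁))
    (h₂ : v₂ ^ 2 ≤ z₂ * (1 - z₂)) (hm : McCormick 1 z₁ z₂ (z₁ * z₂ + v₁ * v₂)) :
    (![z₁, z₂], !![z₁ ^ 2 + v₁ ^ 2, z₁ * z₂ + v₁ * v₂; z₁ * z₂ + v₁ * v₂, z₂ ^ 2 + v₂ ^ 2],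
      ![1, 1], 1) ∈ hull := by
  obtain ⟨a, ha, ⟨k1, k2⟩, ⟨k3, k4⟩, ⟨k5, k6⟩, ⟨k7, k8⟩⟩ := exists_two_points h₁ h₂ hm
  have g1 := generator_pair_mem_hull (Or.inr rfl) (Or.inr rfl) k1 k3 k2 k4
  have g2 := generator_pair_mem_hull (Or.inr rfl) (Or.inr rfl) k5 k7 k6 k8
  have hs : 0 < a + a⁻¹ := by positivity
  have := convex_convexHull ℝ generators g1 g2 (a := a⁻¹ / (a + a⁻¹)) (b := a / (a + a⁻¹))
    (by positivity) (by positivity) (by field_simp; ring)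
  refine Set.mem_of_eq_of_mem ?_ this
  simp only [Prod.smul_mk, Prod.mk_add_mk, Prod.mk.injEq]
  have hsne : a ^ 2 + 1 ≠ 0 := by positivity
  refine ⟨?_, ?_, ?_, ?_⟩
  · ext i
    fin_cases i <;> simp <;> field_simp <;> ring
  · ext i j
    fin_cases i <;> fin_cases j <;> simp <;> field_simp <;> ring
  · ext i
    fin_cases i <;> simp <;> field_simp <;> ring
  · simp
    field_simp
    ring

/-- The convex hull of the points `(x, x xᵀ)` with `x` in the unit square, up to lowering the
diagonal, in homogenized form. -/
theorem exists_square_mem_hull {w z₁ z₂ A c B : ℝ} (hw : 0 ≤ w) (hm : McCormick w z₁ z₂ c)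
    (hA : A ≤ z₁) (hB : B ≤ z₂) (hq : FormNonneg w z₁ z₂ A c B) :
    ∃ ζ₁ ζ₂ a b k, w * ζ₁ = z₁ ∧ w * ζ₂ = z₂ ∧ w * k = c ∧ w * a ≤ A ∧ w * b ≤ B ∧
      (![ζ₁, ζ₂], !![a, k; k, b], ![1, 1], 1) ∈ hull := by
  rcases hw.eq_or_lt with h0 | h0
  · subst h0
    have hA0 : 0 ≤ A := by simpa using hq 0 1 0
    have hB0 : 0 ≤ B := by simpa using hq 0 0 1
    obtain ⟨m1, m2, m3, m4⟩ := hm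
    refine ⟨0, 0, 0, 0, 0, by linarith, by linarith, by linarith, by linarith, by linarith, ?_⟩
    simpa using generator_pair_mem_hull (Or.inr rfl) (Or.inr rfl) le_rfl le_rfl zero_le_one
      zero_le_one
  have hi : 0 ≤ w⁻¹ := inv_nonneg.2 hw
  have hwi : w⁻¹ * w = 1 := inv_mul_cancel₀ h0.ne'
  have hm' := hm.combo hm hi le_rfl
  have hq' := hq.smul hi
  have hA' := mul_le_mul_of_nonneg_left hA hi
  have hB' := mul_le_mul_of_nonneg_left hB hi
  simp only [zero_mul, add_zero] at hm'
  rw [hwi] at hm' hq'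
  have e : ∀ r, w * (w⁻¹ * r) = r := fun r => by field_simp
  have eA := e A
  have eB := e B
  have e1 := e z₁
  have e2 := e z₂
  have ec := e c
  generalize w⁻¹ * z₁ = ζ₁ at *
  generalize w⁻¹ * z₂ = ζ₂ at *
  generalize w⁻¹ * c = k at *
  generalize w⁻¹ * A = a at *
  generalize w⁻¹ * B = b at *
  have hD : 0 ≤ b - ζ₂ ^ 2 := by linarith [hq'.sq_le one_pos]
  have hDa : 0 ≤ a - ζ₁ ^ 2 := by linarith [hq'.swap.sq_le one_pos]
  -- `v₂` uses all the slack in the second diagonal entry, the off-diagonal entry dictates `v₁`, and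
  -- the Schur complement bounds `v₁ ^ 2` by the slack in the first.
  set v₂ := √(b - ζ₂ ^ 2) with hv₂
  have hv₂sq : v₂ ^ 2 = b - ζ₂ ^ 2 := Real.sq_sqrt hD
  obtain ⟨v₁, hv, hv₁⟩ : ∃ v₁, ζ₁ * ζ₂ + v₁ * v₂ = k ∧ ζ₁ ^ 2 + v₁ ^ 2 ≤ a := by
    rcases hD.eq_or_lt with hd | hd
    · refine ⟨0, ?_, by linarith⟩
      linarith [hq'.mul_eq one_pos (by linarith)]
    · have hpos : 0 < v₂ := Real.sqrt_pos.2 hd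
      refine ⟨(k - ζ₁ * ζ₂) / v₂, by field_simp; ring, ?_⟩
      have := (formNonneg_iff_schur one_pos (by linarith)).1 hq'
      rw [div_pow, hv₂sq]
      simp only [one_mul, div_one] at this
      linarith
  refine ⟨ζ₁, ζ₂, ζ₁ ^ 2 + v₁ ^ 2, ζ₂ ^ 2 + v₂ ^ 2, k, e1, e2, ec, ?_, ?_, ?_⟩
  · rw [← eA]
    exact mul_le_mul_of_nonneg_left hv₁ hw
  · rw [← eB, hv₂sq]
    exact mul_le_mul_of_nonneg_left (by linarith) hw
  · subst hv
    exact rank_one_mem_hull (by linarith) (by linarith) hm'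

/-! ### Reassembling a lifted point from the vertices of `y` -/

theorem exists_scaled {l α : ℝ} (h0 : 0 ≤ α) (hl : α ≤ l) :
    ∃ ρ, 0 ≤ ρ ∧ ρ ≤ 1 ∧ l * ρ = α ∧ l * ρ ^ 2 = l⁻¹ * α ^ 2 := by
  rcases (h0.trans hl).eq_or_lt with h | h
  · have : α = 0 := by linarith
    subst this h
    exact ⟨0, by simp⟩
  · exact ⟨α / l, div_nonneg h0 h.le, (div_le_one h).2 hl, by field_simp, by field_simp⟩

theorem image_lifted_subset : Prod.fst '' lifted ⊆ hull := by
  rintro _ ⟨_, ⟨x, X, y, Y, α₀, rfl, hL₀, hM⟩, rfl⟩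
  obtain ⟨α, hL, hF⟩ := exists_mem_liftedFour hL₀ hM
  rw [linearConstraints_iff] at hL
  obtain ⟨h1, h2, h3, h4, h5, h6, h7⟩ := hL
  obtain ⟨ζ₁, ζ₂, a, b, k, e1, e2, e3, e4, e5, hbox⟩ :=
    exists_square_mem_hull h7.nonneg h4 (min_le_right _ _) (min_le_right _ _) hF
  obtain ⟨ρ₁, r1, r2, r3, r4⟩ := exists_scaled (h5 0) (h6 0)
  obtain ⟨ρ₂, s1, s2, s3, s4⟩ := exists_scaled (h5 1) (h6 1)
  have g00 := generator_pair_mem_hull (Or.inl rfl) (Or.inl rfl) le_rfl le_rfl le_rfl le_rfl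
  have g10 := generator_pair_mem_hull (Or.inr rfl) (Or.inl rfl) r1 le_rfl r2 le_rfl
  have g01 := generator_pair_mem_hull (Or.inl rfl) (Or.inr rfl) le_rfl s1 le_rfl s2
  -- The weights are the joint distribution on `{0,1}²` with marginals `y` and mass `Y` at `(1, 1)`.
  have hsum := (convex_convexHull ℝ generators).sum_mem (t := Finset.univ)
    (w := ![1 - y 0 - y 1 + Y, y 0 - Y, y 1 - Y, Y]) (z := ![_, _, _, _])
    (fun i _ => by
      fin_cases i
      · simp; linarith [h7.lower]
      · simpa using h7.le_left
      · simpa using h7.le_right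
      · simpa using h7.nonneg)
    (by simp [Fin.sum_univ_four]; ring)
    (fun i _ => by
      fin_cases i
      exacts [g00, g10, g01, hbox])
  have hlow : (![x 0, x 1], !![(y 0 - Y) * ρ₁ ^ 2 + Y * a, X 0 1;
      X 0 1, (y 1 - Y) * ρ₂ ^ 2 + Y * b], y, Y) ∈ hull := by
    refine Set.mem_of_eq_of_mem ?_ hsum
    simp only [Fin.sum_univ_four, cons_val, Prod.smul_mk, Prod.mk_add_mk, Prod.mk.injEq]
    refine ⟨?_, ?_, ?_, ?_⟩
    · ext i
      fin_cases i <;> simp <;> linarith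
    · ext i j
      fin_cases i <;> fin_cases j <;> simp <;> linarith
    · ext i
      fin_cases i <;> simp
    · simp
  have m1 := min_le_left (X 0 0 - (y 0 - Y)⁻¹ * α 0 ^ 2) (x 0 - α 0)
  have m2 := min_le_left (X 1 1 - (y 1 - Y)⁻¹ * α 1 ^ 2) (x 1 - α 1)
  -- The sum matches everything except the diagonal, which is at most that of `X`.
  have hup := raise_both_mem_hull hlow (a' := X 0 0) (b' := X 1 1) (by linarith) (h2 0)
    (by linarith) (h2 1)
  have ex : ![x 0, x 1] = x := by
    ext i
    fin_cases i <;> rfl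
  have eX : !![X 0 0, X 0 1; X 0 1, X 1 1] = X := by
    have := h1.apply 0 1
    ext i j
    fin_cases i <;> fin_cases j <;> simp [this]
  rwa [ex, eX] at hup

end SwitchingHull

theorem theorem4p5 :
    -- the hull is the projection of the tuples `(x, X, y, Y₁₂, α)` that satisfy the linear
    -- constraints and the single condition `M(β₂₂) ⪰ 0`
    SwitchingHull.hull = Prod.fst '' SwitchingHull.lifted ∧
    -- these constraints are convex
    Convex ℝ SwitchingHull.lifted ∧
    -- the condition `M(β₂₂) ⪰ 0` is the `5 × 5` condition
    (∀ (x : Fin 2 → ℝ) (X : Matrix (Fin 2) (Fin 2) ℝ) (y : Fin 2 → ℝ) (Y : ℝ) (α : Fin 2 → ℝ),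
      SwitchingHull.LinearConstraints x X y Y α →
      ((SwitchingHull.M x X Y α (SwitchingHull.beta22 y Y α)).PosSemidef ↔
        (SwitchingHull.M5 x X y Y α).PosSemidef)) ∧
    -- dropping the other three conditions does not change the projection
    Prod.fst '' SwitchingHull.liftedFour = Prod.fst '' SwitchingHull.lifted := by
  exact ⟨SwitchingHull.hull_subset.antisymm SwitchingHull.image_lifted_subset,
    SwitchingHull.convex_lifted, fun _ _ _ _ _ hL => SwitchingHull.posSemidef_beta22_iff hL,
    SwitchingHull.image_liftedFour⟩
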